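/- Let $n\ge 1$ be an integer, let $q>0$ be real, and let $|\cdot|$ be the Euclidean norm on $\mathbb{R}^n$. Let $u:\mathbb{R}^n\to\mathbb{R}\cup\{+\infty\}$ be a convex, lower semicontinuous function with $\lim_{|x|\to\infty}u(x)=+\infty$, put $\mathrm{dom}(u)=\{x\in\mathbb{R}^n:u(x)<+\infty\}$, and suppose that the origin lies in the interior of $\mathrm{dom}(u)$. Let $\zeta:\mathbb{R}^n\to\mathbb{R}$ be a Lipschitz function such that for every unit vector $\nu$ the finite limit \[\rho_\zeta(\nu)=\lim_{t\to+\infty}\frac{\zeta(t\nu)}{t}\] exists, the function $\rho_\zeta$ is continuous on the unit sphere, and, with $\rho_\zeta$ extended to $\mathbb{R}^n$ by $\rho_\zeta(x)=|x|\,\rho_\zeta(x/|x|)$ for $x\ne 0$ and $\rho_\zeta(0)=0$, the function $|\rho_\zeta-\zeta|$ is bounded on $\mathbb{R}^n$. Then the integrals \[\int_{\mathbb{R}^n}|\zeta(\nabla u(x))|\,e^{-u(x)}\,|x|^{q-n}\,dx\qquad\text{and}\qquad\int_{\partial\,\mathrm{dom}(u)}|\rho_\zeta(N(y))|\,e^{-u(y)}\,|y|^{q-n}\,d\mathcal{H}^{n-1}(y)\]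 are finite. Here $e^{-u}=0$ where $u=+\infty$, $\nabla u$ is the gradient of $u$ (which exists at almost every point of $\mathrm{dom}(u)$), $\mathcal{H}^{n-1}$ is the $(n-1)$-dimensional Hausdorff measure, and $N(y)$ is the outer unit normal vector of the convex set $\mathrm{dom}(u)$ at $y$ (which is unique at $\mathcal{H}^{n-1}$-almost every boundary point). -/

import Mathlib

open MeasureTheory Filter Topology

noncomputable section

/-- Effective domain of an extended-real-valued function. -/
def effDom {E : Type*} (u : E → EReal) : Set E :=
  {x | u x ≠ ⊤}

/-- Epigraph of an extended-real-valued function, as a subset of `E × ℝ`. -/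
def epigraph {E : Type*} (u : E → EReal) : Set (E × ℝ) :=
  {p | u p.1 ≤ (p.2 : EReal)}

/-- `Conv(ℝⁿ)`: convex, lower semicontinuous functions `ℝⁿ → ℝ ∪ {+∞}` that are not identically
`+∞`. Values are taken in `EReal`, the value `-∞` being excluded by `ne_bot`. -/
structure IsConv {n : ℕ} (u : EuclideanSpace ℝ (Fin n) → EReal) : Prop where
  ne_bot : ∀ x, u x ≠ ⊥
  convex : Convex ℝ (epigraph u)
  lsc : LowerSemicontinuous u
  proper : ∃ x, u x ≠ ⊤

/-- `Conv_coe(ℝⁿ)`: members of `Conv(ℝⁿ)` with `u(x) → +∞` as `|x| → ∞`. -/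
structure IsConvCoe {n : ℕ} (u : EuclideanSpace ℝ (Fin n) → EReal) : Prop
    extends IsConv u where
  coercive : Tendsto u (Bornology.cobounded (EuclideanSpace ℝ (Fin n))) (𝓝 ⊤)

/-- The number `e^{-u(x)}`, equal to `0` where `u(x) = +∞`. -/
def expNeg {n : ℕ} (u : EuclideanSpace ℝ (Fin n) → EReal) (x : EuclideanSpace ℝ (Fin n)) : ℝ :=
  (EReal.exp (-u x)).toReal

/-- The gradient of `u`. It is meaningful at the points of the interior of the domain where `u` is
differentiable, hence at almost every point of the domain when `u` is convex. -/
def grad {n : ℕ} (u : EuclideanSpace ℝ (Fin n) → EReal) (x : EuclideanSpace ℝ (Fin n)) :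
    EuclideanSpace ℝ (Fin n) :=
  gradient (fun z => (u z).toReal) x

/-- The recession function `ρ_ζ`: on the unit sphere it is `ν ↦ lim_{t → +∞} ζ(tν)/t`, and it is
extended to the whole space by `ρ_ζ(x) = |x| ρ_ζ(x/|x|)`, with `ρ_ζ(0) = 0`. -/
def recFun {n : ℕ} (ζ : EuclideanSpace ℝ (Fin n) → ℝ) (x : EuclideanSpace ℝ (Fin n)) : ℝ :=
  ‖x‖ * limUnder atTop (fun t : ℝ => ζ (t • (‖x‖⁻¹ • x)) / t)

/-- The class `C_rec(ℝⁿ)`. -/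
structure IsCrec {n : ℕ} (ζ : EuclideanSpace ℝ (Fin n) → ℝ) : Prop where
  continuous : Continuous ζ
  /-- The limits defining the recession function exist and are finite. -/
  exists_lim : ∀ ν : EuclideanSpace ℝ (Fin n), ‖ν‖ = 1 →
    ∃ l : ℝ, Tendsto (fun t : ℝ => ζ (t • ν) / t) atTop (𝓝 l)
  continuousOn_recFun : ContinuousOn (recFun ζ) (Metric.sphere 0 1)
  bounded_sub : ∃ C : ℝ, ∀ x, |recFun ζ x - ζ x| ≤ C

/-- Outer unit normal vectors of `K` at the point `y`. -/
def unitNormals {n : ℕ} (K : Set (EuclideanSpace ℝ (Fin n))) (y : EuclideanSpace ℝ (Fin n)) :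
    Set (EuclideanSpace ℝ (Fin n)) :=
  {ν | ‖ν‖ = 1 ∧ ∀ x ∈ K, inner ℝ (x - y) ν ≤ 0}

open Classical in
/-- The Gauss map `N_K` of a convex set: the outer unit normal at `y`, wherever there is exactly
one, which is the case for `H^{n-1}`-almost every boundary point of a convex set with interior
points. On the remaining null set of boundary points the value is irrelevant. -/
def gaussMap {n : ℕ} (K : Set (EuclideanSpace ℝ (Fin n))) (y : EuclideanSpace ℝ (Fin n)) :
    EuclideanSpace ℝ (Fin n) :=
  if h : ∃! ν, ν ∈ unitNormals K y then h.choose else 0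

end

/-! ### Exponential decay of e^{-u} and integrability of e^{-u}|x|^{q-n} -/

section ConvexBasics

variable {n : ℕ} {u : EuclideanSpace ℝ (Fin n) → EReal}

/-! Coercivity and convexity force linear growth of u, so e^{-u} decays exponentially and I = ∫
e^{-u}|x|^{q-n} is finite.

Gradient integral. Since ζ is Lipschitz, it is enough to integrate |∇u|. As u < u(0) + 1 on a ball
of radius r about 0, the tangent plane inequality gives r|∇u(x)| ≤ ⟨∇u(x), x⟩ + D + 1, where D ≥
u(0) - u (`IsConv.exists_norm_grad_le`). Up to sign, the radial term ⟨∇u, x⟩e^{-u} is the derivative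
of e^{-u} under dilation, so it is controlled without any divergence theorem: ∫
e^{-u((1+t)x)}|x|^{q-n} dx = (1+t)^{-q} I by scaling. The function e^{tD}e^{-u(x)} - e^{-u((1+t)x)}
is nonnegative by convexity, its integral against the weight is O(t), and Fatou's lemma as t → 0
bounds the integral of (⟨∇u, x⟩ + D)e^{-u}|x|^{q-n}.

Boundary integral. The boundary avoids a ball about 0, ρ_ζ is bounded on the sphere and e^{-u}
decays exponentially, so polynomial growth of the boundary measure in balls suffices. Moving points
outward along normals to the surface of a cube does not decrease distances, which bounds that
measure by O(R^{n-1}) (`hausdorffMeasure_frontier_inter_closedBall_le`). -/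

theorem expNeg_eq_zero {x : EuclideanSpace ℝ (Fin n)} (hx : u x = ⊤) : expNeg u x = 0 := by
  simp [expNeg, hx]

theorem expNeg_eq_exp (hu : IsConv u) {x : EuclideanSpace ℝ (Fin n)} (hx : x ∈ effDom u) :
    expNeg u x = Real.exp (-(u x).toReal) := by
  rw [expNeg]
  conv_lhs => rw [← EReal.coe_toReal hx (hu.ne_bot x)]
  rw [← EReal.coe_neg, EReal.exp_coe, ENNReal.toReal_ofReal (Real.exp_pos _).le]

theorem expNeg_nonneg (x : EuclideanSpace ℝ (Fin n)) : 0 ≤ expNeg u x := ENNReal.toReal_nonneg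

theorem measurable_expNeg (hu : IsConv u) : Measurable (expNeg u) :=
  (EReal.measurable_exp.comp hu.lsc.measurable.neg).ennreal_toReal

theorem measurable_grad : Measurable (grad u) :=
  (InnerProductSpace.toDual ℝ _).symm.continuous.measurable.comp (measurable_fderiv ℝ _)

theorem IsConv.convexOn_toReal (hu : IsConv u) :
    ConvexOn ℝ (effDom u) (fun x => (u x).toReal) := by
  have key : ∀ x ∈ effDom u, ∀ y ∈ effDom u, ∀ a b : ℝ, 0 ≤ a → 0 ≤ b → a + b = 1 →
      u (a • x + b • y) ≤ ((a * (u x).toReal + b * (u y).toReal : ℝ) : EReal) := by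
    intro x hx y hy a b ha hb hab
    have h1 : (x, (u x).toReal) ∈ epigraph u := EReal.le_coe_toReal hx
    have h2 : (y, (u y).toReal) ∈ epigraph u := EReal.le_coe_toReal hy
    exact hu.convex h1 h2 ha hb hab
  refine ⟨fun x hx y hy a b ha hb hab h => ?_, fun x hx y hy a b ha hb hab => ?_⟩
  · have := key x hx y hy a b ha hb hab
    rw [h, top_le_iff] at this
    exact EReal.coe_ne_top _ this
  · have := key x hx y hy a b ha hb hab
    have h' := EReal.toReal_le_toReal this (hu.ne_bot _) (EReal.coe_ne_top _)
    rwa [EReal.toReal_coe] at h'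

/-- A differentiable convex function lies above its tangent planes. -/
theorem ConvexOn.add_inner_gradient_le {s : Set (EuclideanSpace ℝ (Fin n))}
    {f : EuclideanSpace ℝ (Fin n) → ℝ} (hf : ConvexOn ℝ s f) {x y : EuclideanSpace ℝ (Fin n)}
    (hx : x ∈ s) (hy : y ∈ s) (hd : DifferentiableAt ℝ f x) :
    f x + inner ℝ (gradient f x) (y - x) ≤ f y := by
  have hg : HasDerivAt (fun t : ℝ => f (AffineMap.lineMap x y t))
      (inner ℝ (gradient f x) (y - x)) 0 := by
    have h1 : HasFDerivAt f (fderiv ℝ f x) (AffineMap.lineMap x y (0 : ℝ)) := by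
      simpa using hd.hasFDerivAt
    have h2 := h1.comp_hasDerivAt (0 : ℝ) (AffineMap.hasDerivAt_lineMap (a := x) (b := y))
    rw [gradient, InnerProductSpace.toDual_symm_apply]
    exact h2
  have hc : ConvexOn ℝ ((AffineMap.lineMap x y : ℝ →ᵃ[ℝ] _) ⁻¹' s)
      (fun t : ℝ => f (AffineMap.lineMap x y t)) := hf.comp_affineMap _
  have := hc.le_slope_of_hasDerivAt (x := 0) (y := 1) (by simpa using hx) (by simpa using hy)
    one_pos hg
  simp only [slope, vsub_eq_sub, sub_zero, inv_one, one_smul, AffineMap.lineMap_apply_one,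
    AffineMap.lineMap_apply_zero] at this
  linarith

/-- A coercive convex function grows at least linearly. -/
theorem IsConvCoe.exists_linear_le (hu : IsConvCoe u) (h0 : (0 : EuclideanSpace ℝ (Fin n)) ∈ effDom u) :
    ∃ a > 0, ∃ b : ℝ, ∀ x ∈ effDom u, a * ‖x‖ - b ≤ (u x).toReal := by
  have hc := hu.toIsConv.convexOn_toReal
  set c := (u 0).toReal with hcdef
  have hev : ∀ᶠ x in Bornology.cobounded (EuclideanSpace ℝ (Fin n)), ((c + 1 : ℝ) : EReal) < u x :=
    hu.coercive.eventually (lt_mem_nhds (EReal.coe_lt_top _))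
  obtain ⟨R0, hR0⟩ : ∃ R : ℝ, ∀ x, R ≤ ‖x‖ → ((c + 1 : ℝ) : EReal) < u x := by
    rw [← comap_norm_atTop, eventually_comap, eventually_atTop] at hev
    obtain ⟨R, hR⟩ := hev
    exact ⟨R, fun x hx => hR _ hx x rfl⟩
  set R := max R0 1
  have hR1 : 1 ≤ R := le_max_right _ _
  obtain ⟨z, hz, hzmin⟩ := LowerSemicontinuousOn.exists_isMinOn (s := Metric.closedBall 0 R)
    ⟨(0 : EuclideanSpace ℝ (Fin n)), by simp; linarith⟩ (isCompact_closedBall _ _)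
    (hu.lsc.lowerSemicontinuousOn _)
  have hR : 0 < R := by linarith
  -- Outside radius R, u exceeds u(0) + 1 where the segment from 0 to x crosses the sphere of radius
  -- R, so convexity gives slope at least 1/R. Inside, the minimum u(z) serves as lower bound and
  -- the linear term is at most 1.
  refine ⟨1 / R, by positivity, max (-c) (1 - (u z).toReal), fun x hx => ?_⟩
  rcases le_or_gt ‖x‖ R with hxR | hxR
  · have h1 : u z ≤ u x := hzmin (by simpa using hxR)
    have h2 := EReal.toReal_le_toReal h1 (hu.ne_bot _) hx
    have h3 : 1 / R * ‖x‖ ≤ 1 := by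
      rw [one_div, inv_mul_le_iff₀ hR]; linarith
    linarith [le_max_right (-c) (1 - (u z).toReal)]
  · have hxp : 0 < ‖x‖ := hR.trans hxR
    set t := R / ‖x‖
    have ht : 0 < t := by positivity
    have ht1 : t ≤ 1 := by rw [div_le_one hxp]; exact hxR.le
    have h := hc.2 hx h0 ht.le (sub_nonneg.2 ht1) (by ring)
    have hmem := hc.1 hx h0 ht.le (sub_nonneg.2 ht1) (by ring)
    simp only [smul_zero, add_zero, smul_eq_mul] at h hmem
    have hn : ‖t • x‖ = R := by
      rw [norm_smul, Real.norm_of_nonneg ht.le]; exact div_mul_cancel₀ _ hxp.ne'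
    have h1 := hR0 (t • x) (by rw [hn]; exact le_max_left _ _)
    rw [← EReal.coe_toReal hmem (hu.ne_bot _), EReal.coe_lt_coe_iff] at h1
    have h2 : 1 ≤ t * ((u x).toReal - c) := by linarith
    have h3 : 1 / R * ‖x‖ * t = 1 := by simp only [t]; field_simp
    have h4 : 1 / R * ‖x‖ ≤ (u x).toReal - c := by
      refine le_of_mul_le_mul_right ?_ ht
      rw [h3]; linarith
    linarith [le_max_left (-c) (1 - (u z).toReal)]

theorem IsConvCoe.exists_expNeg_le (hu : IsConvCoe u)
    (h0 : (0 : EuclideanSpace ℝ (Fin n)) ∈ effDom u) :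
    ∃ a > 0, ∃ C : ℝ, 0 ≤ C ∧ ∀ x, expNeg u x ≤ C * Real.exp (-a * ‖x‖) := by
  obtain ⟨a, ha, b, hb⟩ := hu.exists_linear_le h0
  refine ⟨a, ha, Real.exp b, (Real.exp_pos _).le, fun x => ?_⟩
  by_cases hx : x ∈ effDom u
  · rw [expNeg_eq_exp hu.toIsConv hx, ← Real.exp_add, Real.exp_le_exp]
    linarith [hb x hx]
  · rw [expNeg_eq_zero (not_not.1 hx)]; positivity

/-- In polar coordinates the Jacobian t^{n-1} turns the weight into t^{q-1}, integrable at 0 because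
q > 0. -/
theorem integrable_exp_neg_mul_norm_mul_rpow (hn : 1 ≤ n) {q a : ℝ} (hq : 0 < q) (ha : 0 < a) :
    Integrable (fun x : EuclideanSpace ℝ (Fin n) =>
      Real.exp (-a * ‖x‖) * ‖x‖ ^ (q - (n : ℝ))) := by
  have : Nontrivial (EuclideanSpace ℝ (Fin n)) := by
    have : Nonempty (Fin n) := ⟨⟨0, hn⟩⟩
    infer_instance
  refine (integrable_fun_norm_addHaar volume
    (f := fun t => Real.exp (-a * t) * t ^ (q - (n : ℝ)))).2 ?_
  have h := integrableOn_rpow_mul_exp_neg_mul_rpow (s := q - 1) (p := 1) (b := a)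
    (by linarith) one_pos ha
  refine h.congr_fun (fun t ht => ?_) measurableSet_Ioi
  have ht : 0 < t := ht
  simp only [finrank_euclideanSpace, Fintype.card_fin, smul_eq_mul, Real.rpow_one]
  rw [← Real.rpow_natCast t (n - 1), mul_left_comm, ← Real.rpow_add ht, mul_comm]
  congr 2
  push_cast [hn]; ring

theorem IsConvCoe.integrable_expNeg_mul_rpow (hu : IsConvCoe u) (hn : 1 ≤ n) {q : ℝ} (hq : 0 < q)
    (h0 : (0 : EuclideanSpace ℝ (Fin n)) ∈ effDom u) :
    Integrable (fun x => expNeg u x * ‖x‖ ^ (q - (n : ℝ))) := by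
  obtain ⟨a, ha, C, hC, h⟩ := hu.exists_expNeg_le h0
  refine ((integrable_exp_neg_mul_norm_mul_rpow hn hq ha).const_mul C).mono'
    ((measurable_expNeg hu.toIsConv).mul (by fun_prop)).aestronglyMeasurable
    (.of_forall fun x => ?_)
  rw [Real.norm_of_nonneg (mul_nonneg (expNeg_nonneg x) (by positivity)), ← mul_assoc]
  exact mul_le_mul_of_nonneg_right (h x) (by positivity)

end ConvexBasics

/-! ### The gradient integral: dilation and Fatou's lemma -/

section GradientIntegral

variable {n : ℕ} {u : EuclideanSpace ℝ (Fin n) → EReal}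

/-- Convexity along the ray through `x`, compared with the value at the origin. -/
theorem IsConv.expNeg_smul_le (hu : IsConv u) (h0 : (0 : EuclideanSpace ℝ (Fin n)) ∈ effDom u)
    {D : ℝ} (hD : ∀ x ∈ effDom u, (u 0).toReal - (u x).toReal ≤ D) {t : ℝ} (ht : 0 ≤ t)
    (x : EuclideanSpace ℝ (Fin n)) :
    expNeg u ((1 + t) • x) ≤ expNeg u x * Real.exp (t * D) := by
  by_cases hx : (1 + t) • x ∈ effDom u
  · have hc := hu.convexOn_toReal
    have hp : 0 < 1 + t := by linarith
    -- These weights exhibit x as a convex combination of (1+t)x and 0.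
    have ha : 0 ≤ (1 + t)⁻¹ := by positivity
    have hb : 0 ≤ t * (1 + t)⁻¹ := by positivity
    have hab : (1 + t)⁻¹ + t * (1 + t)⁻¹ = 1 := by field_simp
    have hmem := hc.1 hx h0 ha hb hab
    have h := hc.2 hx h0 ha hb hab
    simp only [smul_zero, add_zero, smul_smul, inv_mul_cancel₀ hp.ne', one_smul, smul_eq_mul]
      at h hmem
    rw [expNeg_eq_exp hu hx, expNeg_eq_exp hu hmem, ← Real.exp_add, Real.exp_le_exp]
    have h2 := mul_le_mul_of_nonneg_left h hp.le
    have h3 : (1 + t) * ((1 + t)⁻¹ * (u ((1 + t) • x)).toReal + t * (1 + t)⁻¹ * (u 0).toReal)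
        = (u ((1 + t) • x)).toReal + t * (u 0).toReal := by field_simp
    rw [h3] at h2
    have h4 := mul_le_mul_of_nonneg_left (hD x hmem) ht
    linarith
  · rw [expNeg_eq_zero (not_not.1 hx)]
    exact mul_nonneg (expNeg_nonneg x) (Real.exp_pos _).le

/-- Evaluate the tangent plane at x at the point of norm r in the direction of the gradient, where u
is below u(0) + 1. -/
theorem IsConv.exists_norm_grad_le (hu : IsConv u)
    (h0 : (0 : EuclideanSpace ℝ (Fin n)) ∈ interior (effDom u))
    {D : ℝ} (hD : ∀ x ∈ effDom u, (u 0).toReal - (u x).toReal ≤ D) :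
    ∃ r > 0, ∀ x ∈ effDom u, DifferentiableAt ℝ (fun z => (u z).toReal) x →
      r * ‖grad u x‖ ≤ inner ℝ (grad u x) x + D + 1 := by
  have hc := hu.convexOn_toReal
  have hcont : ContinuousAt (fun z => (u z).toReal) 0 :=
    hc.continuousOn_interior.continuousAt (isOpen_interior.mem_nhds h0)
  have hev : ∀ᶠ z in 𝓝 (0 : EuclideanSpace ℝ (Fin n)),
      z ∈ effDom u ∧ (u z).toReal < (u 0).toReal + 1 :=
    Eventually.and (mem_interior_iff_mem_nhds.1 h0) (hcont.eventually (gt_mem_nhds (lt_add_one _)))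
  obtain ⟨r, hr, hball⟩ := Metric.nhds_basis_closedBall.eventually_iff.1 hev
  refine ⟨r, hr, fun x hx hd => ?_⟩
  set g := grad u x with hg
  -- If g = 0 the inverse is 0 and the test point is the origin, still in the ball.
  have hz : (r * ‖g‖⁻¹) • g ∈ Metric.closedBall (0 : EuclideanSpace ℝ (Fin n)) r := by
    rw [mem_closedBall_zero_iff, norm_smul, Real.norm_of_nonneg (by positivity), mul_assoc]
    rcases eq_or_ne ‖g‖ 0 with h | h
    · simp [h, hr.le]
    · rw [inv_mul_cancel₀ h, mul_one]
  obtain ⟨hz1, hz2⟩ := hball hz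
  have h := hc.add_inner_gradient_le hx hz1 hd
  have h' : gradient (fun z => (u z).toReal) x = g := rfl
  rw [h', inner_sub_right, inner_smul_right, real_inner_self_eq_norm_sq] at h
  have h3 : r * ‖g‖⁻¹ * ‖g‖ ^ 2 = r * ‖g‖ := by
    rcases eq_or_ne ‖g‖ 0 with h | h
    · simp [h]
    · field_simp
  have h4 := hD x hx
  linarith

/-- The derivative at `1` along the ray of the comparison function of `IsConv.expNeg_smul_le`. -/
theorem IsConv.hasDerivAt_expNeg_ray (hu : IsConv u) {x : EuclideanSpace ℝ (Fin n)}
    (hx : x ∈ interior (effDom u)) (hd : DifferentiableAt ℝ (fun z => (u z).toReal) x) (D : ℝ) :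
    HasDerivAt (fun t : ℝ => expNeg u x * Real.exp (t * D) - expNeg u ((1 + t) • x))
      ((inner ℝ (grad u x) x + D) * expNeg u x) 0 := by
  have hlin : HasDerivAt (fun t : ℝ => (1 + t) • x) x 0 := by
    simpa using ((hasDerivAt_id (0 : ℝ)).const_add 1).smul_const x
  have hf : HasFDerivAt (fun z => (u z).toReal) (fderiv ℝ (fun z => (u z).toReal) x)
      ((1 + (0 : ℝ)) • x) := by simpa using hd.hasFDerivAt
  have h1 : HasDerivAt (fun t : ℝ => (u ((1 + t) • x)).toReal) (inner ℝ (grad u x) x) 0 := by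
    rw [grad, gradient, InnerProductSpace.toDual_symm_apply]
    exact hf.comp_hasDerivAt (0 : ℝ) hlin
  have h2 : HasDerivAt (fun t : ℝ => expNeg u ((1 + t) • x))
      (expNeg u x * -(inner ℝ (grad u x) x)) 0 := by
    have h3 := h1.neg.exp
    simp only [Pi.neg_apply, add_zero, one_smul] at h3
    rw [← expNeg_eq_exp hu (interior_subset hx)] at h3
    refine h3.congr_of_eventuallyEq ?_
    have hc : Tendsto (fun t : ℝ => (1 + t) • x) (𝓝 0) (𝓝 x) := by
      simpa using hlin.continuousAt.tendsto
    filter_upwards [hc (isOpen_interior.mem_nhds hx)] with t ht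
    exact expNeg_eq_exp hu (interior_subset ht)
  have h4 : HasDerivAt (fun t : ℝ => expNeg u x * Real.exp (t * D)) (expNeg u x * D) 0 := by
    simpa using ((hasDerivAt_id (0 : ℝ)).mul_const D).exp.const_mul (expNeg u x)
  exact (h4.sub h2).congr_deriv (by ring)

/-- The measure |x|^{q-n} dx is homogeneous of degree q under dilations. -/
theorem integral_smul_mul_rpow {f : EuclideanSpace ℝ (Fin n) → ℝ} {q t : ℝ} (ht : 0 < t) :
    ∫ x, f (t • x) * ‖x‖ ^ (q - (n : ℝ)) = t ^ (-q) * ∫ x, f x * ‖x‖ ^ (q - (n : ℝ)) := by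
  have h := Measure.integral_comp_smul volume
    (fun x : EuclideanSpace ℝ (Fin n) => f x * ‖x‖ ^ (q - (n : ℝ))) t
  have h1 : ∀ x : EuclideanSpace ℝ (Fin n), f (t • x) * ‖x‖ ^ (q - (n : ℝ)) =
      t ^ ((n : ℝ) - q) * (f (t • x) * ‖t • x‖ ^ (q - (n : ℝ))) := by
    intro x
    rw [norm_smul, Real.norm_of_nonneg ht.le, Real.mul_rpow ht.le (norm_nonneg _),
      mul_left_comm (f _), ← mul_assoc, ← Real.rpow_add ht]
    simp
  simp_rw [h1]
  rw [integral_const_mul, h, finrank_euclideanSpace, Fintype.card_fin, smul_eq_mul, ← mul_assoc,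
    abs_of_pos (by positivity), ← Real.rpow_natCast, ← Real.rpow_neg ht.le, ← Real.rpow_add ht]
  congr 2; ring

theorem integrable_smul_mul_rpow {f : EuclideanSpace ℝ (Fin n) → ℝ} {q t : ℝ} (ht : 0 < t)
    (hf : Integrable fun x => f x * ‖x‖ ^ (q - (n : ℝ))) :
    Integrable fun x => f (t • x) * ‖x‖ ^ (q - (n : ℝ)) := by
  refine ((hf.comp_smul ht.ne').const_mul (t ^ ((n : ℝ) - q))).congr (.of_forall fun x => ?_)
  simp only
  rw [norm_smul, Real.norm_of_nonneg ht.le, Real.mul_rpow ht.le (norm_nonneg _),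
      mul_left_comm (f _), ← mul_assoc, ← Real.rpow_add ht]
  simp

theorem IsConvCoe.integrable_norm_grad_mul_expNeg_mul_rpow (hu : IsConvCoe u) (hn : 1 ≤ n)
    {q : ℝ} (hq : 0 < q) (h0 : (0 : EuclideanSpace ℝ (Fin n)) ∈ interior (effDom u)) :
    Integrable (fun x => ‖grad u x‖ * expNeg u x * ‖x‖ ^ (q - (n : ℝ))) := by
  have hcv := hu.toIsConv
  have h0' := interior_subset h0
  obtain ⟨a, ha, b, hb⟩ := hu.exists_linear_le h0'
  -- D exists because u is bounded below; D ≥ 0 is needed to replace e^{sD} by e^D for s ≤ 1.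
  obtain ⟨D, hD0, hD⟩ : ∃ D : ℝ, 0 ≤ D ∧ ∀ x ∈ effDom u, (u 0).toReal - (u x).toReal ≤ D := by
    refine ⟨max 0 ((u 0).toReal + b), le_max_left _ _, fun x hx => ?_⟩
    have := hb x hx
    have h' : 0 ≤ a * ‖x‖ := by positivity
    linarith [le_max_right 0 ((u 0).toReal + b)]
  obtain ⟨r, hr, hgrad⟩ := hcv.exists_norm_grad_le h0 hD
  have hI := hu.integrable_expNeg_mul_rpow hn hq h0'
  set w : EuclideanSpace ℝ (Fin n) → ℝ := fun x => ‖x‖ ^ (q - (n : ℝ)) with hw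
  replace hI : Integrable fun x => expNeg u x * w x := hI
  have hw0 : ∀ x, 0 ≤ w x := fun x => by positivity
  have hwm : Measurable w := by fun_prop
  set s : ℕ → ℝ := fun k => 1 / ((k : ℝ) + 1) with hs
  have hs0 : ∀ k, 0 < s k := fun k => by positivity
  have hs1 : ∀ k, s k ≤ 1 := fun k => by
    rw [hs]; simp only; rw [div_le_one (by positivity)]
    linarith [(Nat.cast_nonneg k : (0 : ℝ) ≤ k)]
  have hJ : ∀ k, Integrable fun x => expNeg u ((1 + s k) • x) * w x :=
    fun k => integrable_smul_mul_rpow (by linarith [hs0 k]) hI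
  set I := ∫ x, expNeg u x * w x with hIdef
  have hI0 : 0 ≤ I := integral_nonneg fun x => mul_nonneg (expNeg_nonneg x) (hw0 x)
  set φ : EuclideanSpace ℝ (Fin n) → ℝ → ℝ :=
    fun x t => expNeg u x * Real.exp (t * D) - expNeg u ((1 + t) • x) with hφ
  have hφ0 : ∀ x k, 0 ≤ φ x (s k) :=
    fun x k => sub_nonneg.2 (hcv.expNeg_smul_le h0' hD (hs0 k).le x)
  have hφi : ∀ k, Integrable fun x => (s k)⁻¹ * (φ x (s k) * w x) := by
    intro k
    have h1 := (hI.const_mul (Real.exp (s k * D))).sub (hJ k)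
    refine (h1.const_mul (s k)⁻¹).congr (.of_forall fun x => ?_)
    simp only [hφ, Pi.sub_apply]
    ring
  have hφle : ∀ k, ∫ x, (s k)⁻¹ * (φ x (s k) * w x) ≤ (D * Real.exp D + q) * I := by
    intro k
    have hp := hs0 k
    have e1 : ∫ x, (s k)⁻¹ * (φ x (s k) * w x)
        = (s k)⁻¹ * ((Real.exp (s k * D) - (1 + s k) ^ (-q)) * I) := by
      have e0 : ∫ x, expNeg u ((1 + s k) • x) * w x = (1 + s k) ^ (-q) * I :=
        integral_smul_mul_rpow (by linarith)
      rw [integral_const_mul, sub_mul, ← e0]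
      congr 1
      rw [hIdef, ← integral_const_mul, ← integral_sub (hI.const_mul _) (hJ k)]
      congr 1
      ext x
      simp only [hφ]; ring
    rw [e1, ← mul_assoc]
    refine mul_le_mul_of_nonneg_right ?_ hI0
    rw [inv_mul_le_iff₀ hp]
    -- Bernoulli-type bound, from e^x ≥ 1 + x and log(1+s) ≤ s.
    have e2 : 1 - q * s k ≤ (1 + s k) ^ (-q) := by
      rw [Real.rpow_def_of_pos (by linarith)]
      have h1 := Real.add_one_le_exp (Real.log (1 + s k) * -q)
      have h2 := Real.log_le_sub_one_of_pos (x := 1 + s k) (by linarith)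
      nlinarith
    -- This is e^x ≤ 1 + x e^x, equivalent to e^{-x} ≥ 1 - x, with x = sD ≤ D.
    have e3 : Real.exp (s k * D) ≤ 1 + s k * (D * Real.exp D) := by
      have h1 := Real.add_one_le_exp (-(s k * D))
      have h2 := mul_le_mul_of_nonneg_left h1 (Real.exp_pos (s k * D)).le
      rw [← Real.exp_add, add_neg_cancel, Real.exp_zero] at h2
      have h3 : Real.exp (s k * D) ≤ Real.exp D := by
        rw [Real.exp_le_exp]; nlinarith [hs1 k]
      have h4 := mul_le_mul_of_nonneg_left h3 (mul_nonneg hp.le hD0)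
      linarith
    linarith
  set F : ℕ → EuclideanSpace ℝ (Fin n) → ENNReal :=
    fun k x => ENNReal.ofReal ((s k)⁻¹ * (φ x (s k) * w x)) with hF
  have hem := measurable_expNeg hcv
  have hFm : ∀ k, Measurable (F k) := fun k => by
    refine ENNReal.measurable_ofReal.comp (measurable_const.mul (Measurable.mul ?_ hwm))
    exact (hem.mul_const _).sub (hem.comp (measurable_const_smul (1 + s k)))
  have hfatou : ∫⁻ x, liminf (fun k => F k x) atTop ≠ ⊤ := by
    refine ne_top_of_le_ne_top (ENNReal.ofReal_ne_top (r := (D * Real.exp D + q) * I)) ?_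
    refine (lintegral_liminf_le hFm).trans ?_
    refine liminf_le_of_le (by isBoundedDefault) fun c hc => ?_
    obtain ⟨k, hk⟩ := hc.exists
    refine hk.trans ?_
    rw [hF, ← ofReal_integral_eq_lintegral_ofReal (hφi k) (.of_forall fun x =>
      mul_nonneg (inv_nonneg.2 (hs0 k).le) (mul_nonneg (hφ0 x k) (hw0 x)))]
    exact ENNReal.ofReal_le_ofReal (hφle k)
  -- The second summand pays for the +1 in the gradient bound; the frontier of the domain is null by
  -- convexity.
  have hbound : ∀ᵐ x, ENNReal.ofReal (r * (‖grad u x‖ * expNeg u x * w x)) ≤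
      liminf (fun k => F k x) atTop + ENNReal.ofReal (expNeg u x * w x) := by
    have hfr : ∀ᵐ x, x ∉ frontier (effDom u) :=
      measure_eq_zero_iff_ae_notMem.1 (hcv.convexOn_toReal.1.addHaar_frontier volume)
    filter_upwards [hfr] with x hx
    by_cases hxd : x ∈ effDom u
    · by_cases hd : DifferentiableAt ℝ (fun z => (u z).toReal) x
      · have hxi : x ∈ interior (effDom u) := by
          by_contra h
          exact hx ⟨subset_closure hxd, h⟩
        have hder := (hcv.hasDerivAt_expNeg_ray hxi hd D).tendsto_slope_zero
        have hs' : Tendsto s atTop (𝓝[≠] 0) :=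
          tendsto_nhdsWithin_iff.2 ⟨tendsto_one_div_add_atTop_nhds_zero_nat,
            .of_forall fun k => (hs0 k).ne'⟩
        have hlim : Tendsto (fun k => F k x) atTop
            (𝓝 (ENNReal.ofReal ((inner ℝ (grad u x) x + D) * expNeg u x * w x))) := by
          refine ENNReal.tendsto_ofReal (((hder.comp hs').mul_const (w x)).congr fun k => ?_)
          simp [hφ, mul_assoc]
        rw [hlim.liminf_eq]
        refine le_trans (ENNReal.ofReal_le_ofReal ?_) ENNReal.ofReal_add_le
        have h := mul_le_mul_of_nonneg_right (hgrad x hxd hd)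
          (mul_nonneg (expNeg_nonneg (u := u) x) (hw0 x))
        linarith
      -- The gradient defaults to 0 where u is not differentiable, so almost-everywhere
      -- differentiability is never needed.
      · have : grad u x = 0 := by
          simp [grad, gradient, fderiv_zero_of_not_differentiableAt hd]
        simp [this]
    · simp [expNeg_eq_zero (not_not.1 hxd)]
  have hfin : ∫⁻ x, ENNReal.ofReal (r * (‖grad u x‖ * expNeg u x * w x)) ≠ ⊤ := by
    refine ne_top_of_le_ne_top ?_ (lintegral_mono_ae hbound)
    have hm : Measurable fun x => ENNReal.ofReal (expNeg u x * w x) := (hem.mul hwm).ennreal_ofReal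
    rw [lintegral_add_right _ hm]
    exact ENNReal.add_ne_top.2 ⟨hfatou, hI.lintegral_lt_top.ne⟩
  have hm : Measurable fun x => ‖grad u x‖ * expNeg u x * w x :=
    (measurable_grad.norm.mul hem).mul hwm
  have hri : Integrable fun x => r * (‖grad u x‖ * expNeg u x * w x) :=
    (lintegral_ofReal_ne_top_iff_integrable (hm.const_mul r).aestronglyMeasurable
      (.of_forall fun x => mul_nonneg hr.le
        (mul_nonneg (mul_nonneg (norm_nonneg _) (expNeg_nonneg x)) (hw0 x)))).1 hfin
  exact (integrable_const_mul_iff (IsUnit.mk0 r hr.ne') _).1 hri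

theorem IsConvCoe.integrable_comp_grad_mul_expNeg_mul_rpow (hu : IsConvCoe u) (hn : 1 ≤ n)
    {q : ℝ} (hq : 0 < q) (h0 : (0 : EuclideanSpace ℝ (Fin n)) ∈ interior (effDom u))
    {ζ : EuclideanSpace ℝ (Fin n) → ℝ} {L : NNReal} (hL : LipschitzWith L ζ) :
    Integrable (fun x => |ζ (grad u x)| * expNeg u x * ‖x‖ ^ (q - (n : ℝ))) := by
  have h1 := (hu.integrable_expNeg_mul_rpow hn hq (interior_subset h0)).const_mul |ζ 0|
  have h2 := (hu.integrable_norm_grad_mul_expNeg_mul_rpow hn hq h0).const_mul (L : ℝ)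
  have hm : Measurable fun x => |ζ (grad u x)| := by
    have := (hL.continuous.measurable.comp (measurable_grad (u := u))).norm
    exact this
  refine (h1.add h2).mono' ((hm.mul (measurable_expNeg hu.toIsConv)).mul
    (by fun_prop)).aestronglyMeasurable (.of_forall fun x => ?_)
  have he := expNeg_nonneg (u := u) x
  rw [Real.norm_of_nonneg (by positivity)]
  have h3 : |ζ (grad u x)| ≤ |ζ 0| + L * ‖grad u x‖ := by
    have h := hL.dist_le_mul (grad u x) 0
    rw [Real.dist_eq, dist_zero_right] at h
    have h' := abs_sub_abs_le_abs_sub (ζ (grad u x)) (ζ 0)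
    linarith
  have h4 : (0 : ℝ) ≤ expNeg u x * ‖x‖ ^ (q - (n : ℝ)) := by positivity
  have := mul_le_mul_of_nonneg_right h3 h4
  simp only [Pi.add_apply]
  linarith

end GradientIntegral

/-! ### Measurability of the Gauss map and boundedness of ρ_ζ along it -/

section GaussMap

variable {n : ℕ} {K : Set (EuclideanSpace ℝ (Fin n))}

theorem gaussMap_mem_unitNormals {y : EuclideanSpace ℝ (Fin n)}
    (h : ∃! ν, ν ∈ unitNormals K y) : gaussMap K y ∈ unitNormals K y := by
  rw [gaussMap, dif_pos h]
  exact h.choose_spec.1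

theorem gaussMap_eq_zero {y : EuclideanSpace ℝ (Fin n)}
    (h : ¬∃! ν, ν ∈ unitNormals K y) : gaussMap K y = 0 := by
  rw [gaussMap, dif_neg h]

theorem isClosed_normalGraph :
    IsClosed {p : EuclideanSpace ℝ (Fin n) × EuclideanSpace ℝ (Fin n) |
      p.2 ∈ unitNormals K p.1} := by
  have : {p : EuclideanSpace ℝ (Fin n) × EuclideanSpace ℝ (Fin n) | p.2 ∈ unitNormals K p.1} =
      {p | ‖p.2‖ = 1} ∩ ⋂ x ∈ K, {p | inner ℝ (x - p.1) p.2 ≤ 0} := by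
    ext p; simp [unitNormals]
  rw [this]
  refine (isClosed_eq (by fun_prop) (by fun_prop)).inter (isClosed_biInter fun x _ => ?_)
  exact isClosed_le (by fun_prop) (by fun_prop)

/-- Projection along the compact unit sphere is a closed map, and the graph of the normal relation
is closed. -/
theorem isClosed_setOf_exists_unitNormals {F : Set (EuclideanSpace ℝ (Fin n))} (hF : IsClosed F) :
    IsClosed {y | ∃ ν ∈ unitNormals K y, ν ∈ F} := by
  have h : IsClosed {p : EuclideanSpace ℝ (Fin n) ×
      Metric.sphere (0 : EuclideanSpace ℝ (Fin n)) 1 |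
      p.2.1 ∈ unitNormals K p.1 ∧ p.2.1 ∈ F} := by
    refine IsClosed.inter ?_ (hF.preimage (by fun_prop))
    exact isClosed_normalGraph.preimage
      (f := fun p : EuclideanSpace ℝ (Fin n) × Metric.sphere (0 : EuclideanSpace ℝ (Fin n)) 1 =>
        (p.1, p.2.1)) (by fun_prop)
  convert isClosedMap_fst_of_compactSpace _ h using 1
  ext y
  constructor
  · rintro ⟨ν, hν, hνF⟩
    exact ⟨(y, ⟨ν, by simpa using hν.1⟩), ⟨hν, hνF⟩, rfl⟩
  · rintro ⟨⟨y', ν⟩, ⟨h1, h2⟩, rfl⟩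
    exact ⟨ν, h1, h2⟩

theorem isClosed_setOf_exists_unitNormals_dist (ε : ℝ) :
    IsClosed {y | ∃ ν ∈ unitNormals K y, ∃ ν' ∈ unitNormals K y, ε ≤ dist ν ν'} := by
  let X := EuclideanSpace ℝ (Fin n) ×
    (Metric.sphere (0 : EuclideanSpace ℝ (Fin n)) 1 × Metric.sphere (0 : EuclideanSpace ℝ (Fin n)) 1)
  have h1 : IsClosed {p : X | p.2.1.1 ∈ unitNormals K p.1} :=
    isClosed_normalGraph.preimage (f := fun p : X => (p.1, p.2.1.1)) (by fun_prop)
  have h2 : IsClosed {p : X | p.2.2.1 ∈ unitNormals K p.1} :=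
    isClosed_normalGraph.preimage (f := fun p : X => (p.1, p.2.2.1)) (by fun_prop)
  have h3 : IsClosed {p : X | ε ≤ dist p.2.1.1 p.2.2.1} :=
    isClosed_le continuous_const (by fun_prop)
  convert isClosedMap_fst_of_compactSpace _ (h1.inter (h2.inter h3)) using 1
  ext y
  constructor
  · rintro ⟨ν, hν, ν', hν', hd⟩
    exact ⟨(y, ⟨ν, by simpa using hν.1⟩, ⟨ν', by simpa using hν'.1⟩), ⟨hν, hν', hd⟩, rfl⟩
  · rintro ⟨⟨y', ν, ν'⟩, ⟨h1, h2, h3⟩, rfl⟩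
    exact ⟨ν, h1, ν', h2, h3⟩

/-- Failure of uniqueness is a countable union of closed sets, on which two normals are at distance
at least 1/(k+1). -/
theorem measurableSet_setOf_existsUnique_unitNormals :
    MeasurableSet {y | ∃! ν, ν ∈ unitNormals K y} := by
  have : {y | ∃! ν, ν ∈ unitNormals K y} = {y | ∃ ν ∈ unitNormals K y, ν ∈ Set.univ} \
      ⋃ k : ℕ, {y | ∃ ν ∈ unitNormals K y, ∃ ν' ∈ unitNormals K y,
        1 / ((k : ℝ) + 1) ≤ dist ν ν'} := by
    ext y
    simp only [Set.mem_sdiff, Set.mem_iUnion, Set.mem_ofPred_eq, Set.mem_univ, and_true, not_exists,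
      not_and, not_le]
    constructor
    · rintro ⟨ν, hν, huniq⟩
      refine ⟨⟨ν, hν⟩, fun k μ hμ μ' hμ' => ?_⟩
      rw [huniq μ hμ, huniq μ' hμ', dist_self]
      positivity
    · rintro ⟨⟨ν, hν⟩, h⟩
      refine ⟨ν, hν, fun μ hμ => ?_⟩
      by_contra hne
      obtain ⟨k, hk⟩ := exists_nat_one_div_lt (dist_pos.2 hne)
      exact (h k μ hμ ν hν).not_gt hk
  rw [this]
  exact (isClosed_setOf_exists_unitNormals isClosed_univ).measurableSet.diff
    (.iUnion fun k => (isClosed_setOf_exists_unitNormals_dist _).measurableSet)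

theorem measurable_gaussMap : Measurable (gaussMap K) := by
  refine measurable_of_isClosed fun F hF => ?_
  have hU := measurableSet_setOf_existsUnique_unitNormals (K := K)
  have : gaussMap K ⁻¹' F =
      ({y | ∃! ν, ν ∈ unitNormals K y} ∩ {y | ∃ ν ∈ unitNormals K y, ν ∈ F}) ∪
      ({y | ∃! ν, ν ∈ unitNormals K y}ᶜ ∩ {_y | (0 : EuclideanSpace ℝ (Fin n)) ∈ F}) := by
    ext y
    by_cases h : ∃! ν, ν ∈ unitNormals K y
    · have hm := gaussMap_mem_unitNormals h
      simp only [Set.mem_preimage, Set.mem_union, Set.mem_inter_iff, Set.mem_compl_iff,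
        Set.mem_ofPred_eq, h, true_and, not_true_eq_false, false_and, or_false]
      exact ⟨fun hF => ⟨_, hm, hF⟩, fun ⟨ν, hν, hνF⟩ => h.unique hν hm ▸ hνF⟩
    · simp [h, gaussMap_eq_zero h]
  rw [this]
  exact (hU.inter (isClosed_setOf_exists_unitNormals hF).measurableSet).union
    (hU.compl.inter (.const _))

variable {ζ : EuclideanSpace ℝ (Fin n) → ℝ}

/-- The Gauss map takes only unit vectors and 0 as values, and ρ_ζ(0) = 0; hence continuity of ρ_ζ
on the sphere alone gives measurability and boundedness. -/
theorem recFun_gaussMap_eq_indicator (y : EuclideanSpace ℝ (Fin n)) :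
    recFun ζ (gaussMap K y) = (Metric.sphere 0 1).indicator (recFun ζ) (gaussMap K y) := by
  by_cases h : ∃! ν, ν ∈ unitNormals K y
  · rw [Set.indicator_of_mem]
    simpa using (gaussMap_mem_unitNormals h).1
  · rw [gaussMap_eq_zero h, Set.indicator_of_notMem (by simp)]
    simp [recFun]

theorem IsCrec.measurable_recFun_gaussMap (hζ : IsCrec ζ) :
    Measurable fun y => recFun ζ (gaussMap K y) := by
  simp_rw [recFun_gaussMap_eq_indicator]
  have h : Measurable ((Metric.sphere 0 1).indicator (recFun ζ)) := by
    classical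
    rw [← Set.piecewise_eq_indicator]
    exact hζ.continuousOn_recFun.measurable_piecewise continuousOn_const
      Metric.isClosed_sphere.measurableSet
  exact h.comp measurable_gaussMap

theorem IsCrec.exists_abs_recFun_gaussMap_le (hζ : IsCrec ζ) :
    ∃ C, 0 ≤ C ∧ ∀ y, |recFun ζ (gaussMap K y)| ≤ C := by
  obtain ⟨C, hC⟩ := (isCompact_sphere (0 : EuclideanSpace ℝ (Fin n)) 1).exists_bound_of_continuousOn
    hζ.continuousOn_recFun
  refine ⟨max C 0, le_max_right _ _, fun y => ?_⟩
  rw [recFun_gaussMap_eq_indicator, Set.indicator]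
  split_ifs with h
  · exact (hC _ h).trans (le_max_left _ _)
  · simp

end GaussMap

/-! ### Boundary measure of convex sets: comparison with a cube -/

section BoundaryMeasure

theorem lipschitzWith_insertNth {m : ℕ} (i : Fin (m + 1)) (c : ℝ) :
    LipschitzWith 1 (fun w : Fin m → ℝ => (i.insertNth c w : Fin (m + 1) → ℝ)) := by
  refine LipschitzWith.of_dist_le_mul fun w w' => ?_
  rw [NNReal.coe_one, one_mul, dist_pi_le_iff dist_nonneg, Fin.forall_iff_succAbove i]
  exact ⟨by simp, fun j => by simpa using dist_le_pi_dist w w' j⟩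

/-- The boundary of the cube `[-R, R]^(m+1)` has `m`-dimensional measure `O(R^m)`. -/
theorem exists_hausdorffMeasure_cube_boundary_le (m : ℕ) : ∃ C : ℝ, 0 ≤ C ∧ ∀ R : ℝ, 0 ≤ R →
    Measure.hausdorffMeasure (m : ℝ)
      {z : EuclideanSpace ℝ (Fin (m + 1)) | ‖WithLp.ofLp z‖ = R} ≤ ENNReal.ofReal (C * R ^ m) := by
  obtain ⟨L, hL⟩ : ∃ L : NNReal, ∀ (i : Fin (m + 1)) (c : ℝ), LipschitzWith L
      (fun w : Fin m → ℝ => (WithLp.toLp 2 (i.insertNth c w) : EuclideanSpace ℝ (Fin (m + 1)))) :=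
    ⟨_, fun i c => (PiLp.lipschitzWith_toLp 2 _).comp (lipschitzWith_insertNth i c)⟩
  -- There are 2(m+1) faces, each an L-Lipschitz image of a sup-norm ball of volume (2R)^m.
  refine ⟨(m + 1) * 2 * L ^ m * 2 ^ m, by positivity, fun R hR => ?_⟩
  have hcov : {z : EuclideanSpace ℝ (Fin (m + 1)) | ‖WithLp.ofLp z‖ = R} ⊆
      ⋃ p : Fin (m + 1) × Bool, (fun w : Fin m → ℝ =>
        (WithLp.toLp 2 (p.1.insertNth (if p.2 then R else -R) w) :
          EuclideanSpace ℝ (Fin (m + 1)))) '' Metric.closedBall 0 R := by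
    intro z hz
    have hz : ‖WithLp.ofLp z‖ = R := hz
    have hle : ∀ j, ‖z j‖ ≤ R := fun j => hz ▸ norm_le_pi_norm (WithLp.ofLp z) j
    obtain ⟨i, hi⟩ : ∃ i, R ≤ ‖z i‖ := by
      by_contra! h
      have h1 := hle 0
      have h2 := (pi_norm_lt_iff ((norm_nonneg _).trans_lt (h 0))).2 h
      exact h2.ne hz
    have hi' : |z i| = R := le_antisymm (hle i) hi
    refine Set.mem_iUnion.2 ⟨(i, decide (0 ≤ z i)), fun j => z (i.succAbove j), ?_, ?_⟩
    · rw [mem_closedBall_zero_iff, pi_norm_le_iff_of_nonneg hR]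
      exact fun j => hle _
    · have : (if decide (0 ≤ z i) = true then R else -R) = z i := by
        rcases le_or_gt 0 (z i) with h | h
        · simp [h, ← hi', abs_of_nonneg h]
        · simp [h.not_ge, ← hi', abs_of_neg h]
      simp only [this]
      ext j
      exact congrFun (Fin.insertNth_self_removeNth i (WithLp.ofLp z)) j
  have hface : ∀ p : Fin (m + 1) × Bool, Measure.hausdorffMeasure (m : ℝ)
      ((fun w : Fin m → ℝ => (WithLp.toLp 2 (p.1.insertNth (if p.2 then R else -R) w) :
          EuclideanSpace ℝ (Fin (m + 1)))) '' Metric.closedBall 0 R) ≤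
      ENNReal.ofReal (L ^ m * (2 * R) ^ m) := by
    intro p
    refine ((hL _ _).hausdorffMeasure_image_le (Nat.cast_nonneg m) _).trans_eq ?_
    have hv := hausdorffMeasure_pi_real (ι := Fin m)
    rw [Fintype.card_fin] at hv
    rw [hv, Real.volume_pi_closedBall _ hR, Fintype.card_fin, ENNReal.rpow_natCast,
      ENNReal.ofReal_mul (by positivity), ENNReal.ofReal_pow (by positivity),
      ENNReal.ofReal_pow L.coe_nonneg, ENNReal.ofReal_coe_nnreal]
  refine (measure_mono hcov).trans ((measure_iUnion_fintype_le _ _).trans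
    ((Finset.sum_le_sum fun p _ => hface p).trans_eq ?_))
  rw [Finset.sum_const, Finset.card_univ, Fintype.card_prod, Fintype.card_fin, Fintype.card_bool,
    nsmul_eq_mul, ← ENNReal.ofReal_natCast, ← ENNReal.ofReal_mul (by positivity)]
  congr 1
  push_cast
  ring

variable {n : ℕ} {K : Set (EuclideanSpace ℝ (Fin n))}

/-- Hahn–Banach separates y from the open interior; the inequality passes to K, which lies in the
closure of its interior. -/
theorem exists_mem_unitNormals (hK : Convex ℝ K) (hint : (interior K).Nonempty)
    {y : EuclideanSpace ℝ (Fin n)} (hy : y ∈ frontier K) : ∃ ν, ν ∈ unitNormals K y := by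
  obtain ⟨f, hf⟩ := geometric_hahn_banach_open_point hK.interior isOpen_interior hy.2
  set g := (InnerProductSpace.toDual ℝ (EuclideanSpace ℝ (Fin n))).symm f with hg
  have hgf : ∀ x, inner ℝ g x = f x := fun x => InnerProductSpace.toDual_symm_apply
  have hg0 : g ≠ 0 := by
    rintro h
    obtain ⟨x, hx⟩ := hint
    have := hf x hx
    simp [← hgf, h] at this
  refine ⟨‖g‖⁻¹ • g, by simp [norm_smul, hg0], fun x hx => ?_⟩
  have hx' : x ∈ closure (interior K) := by
    rw [hK.closure_interior_eq_closure_of_nonempty_interior hint]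
    exact subset_closure hx
  have hle : f x ≤ f y := by
    have hcl : IsClosed {x | f x ≤ f y} := isClosed_le f.continuous continuous_const
    exact closure_minimal (fun z hz => (hf z hz).le) hcl hx'
  rw [inner_smul_right, real_inner_comm, hgf, map_sub]
  exact mul_nonpos_of_nonneg_of_nonpos (by positivity) (by linarith)

theorem inner_sub_nonpos_of_mem_closure {y ν : EuclideanSpace ℝ (Fin n)}
    (hν : ν ∈ unitNormals K y) {x : EuclideanSpace ℝ (Fin n)} (hx : x ∈ closure K) :
    inner ℝ (x - y) ν ≤ 0 :=
  closure_minimal (fun z hz => hν.2 z hz)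
    (isClosed_le (f := fun x => inner ℝ (x - y) ν) (by fun_prop) continuous_const) hx

/-- A ray starting in the cube `[-R, R]^n` meets its boundary. -/
theorem exists_norm_ofLp_add_smul_eq {y ν : EuclideanSpace ℝ (Fin n)} {R : ℝ} (hy : ‖y‖ ≤ R)
    (hν : ν ≠ 0) : ∃ t : ℝ, 0 ≤ t ∧ ‖WithLp.ofLp (y + t • ν)‖ = R := by
  have hle : ∀ x : EuclideanSpace ℝ (Fin n), ‖WithLp.ofLp x‖ ≤ ‖x‖ := fun x =>
    (pi_norm_le_iff_of_nonneg (norm_nonneg _)).2 fun i => PiLp.norm_apply_le x i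
  have hR : 0 ≤ R := (norm_nonneg y).trans hy
  obtain ⟨i, hi⟩ : ∃ i, ν i ≠ 0 := by
    by_contra! h
    exact hν (by ext i; exact h i)
  have hi : 0 < |ν i| := abs_pos.2 hi
  have hT : 0 ≤ 2 * R / |ν i| := by positivity
  have hcont : ContinuousOn (fun t : ℝ => ‖WithLp.ofLp (y + t • ν)‖) (Set.Icc 0 (2 * R / |ν i|)) := by
    fun_prop
  -- At the final time the i-th coordinate has absolute value at least 2R - R = R, so the
  -- intermediate value theorem applies.
  have hmem : R ∈ Set.Icc (‖WithLp.ofLp (y + (0 : ℝ) • ν)‖)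
      (‖WithLp.ofLp (y + (2 * R / |ν i|) • ν)‖) := by
    constructor
    · simpa using (hle y).trans hy
    · refine le_trans ?_ (norm_le_pi_norm _ i)
      have h1 : |y i| ≤ R := (PiLp.norm_apply_le y i).trans hy
      have h2 : |(2 * R / |ν i|) * ν i| = 2 * R := by
        rw [abs_mul, abs_of_nonneg hT, div_mul_cancel₀ _ hi.ne']
      have h3 := abs_sub_abs_le_abs_sub ((2 * R / |ν i|) * ν i) (-(y i))
      rw [abs_neg, sub_neg_eq_add, add_comm _ (y i), h2] at h3
      simp only [PiLp.add_apply, PiLp.smul_apply, smul_eq_mul, Real.norm_eq_abs]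
      linarith
  obtain ⟨t, ht, h⟩ := intermediate_value_Icc hT hcont hmem
  exact ⟨t, ht.1, h⟩

/-- The outward normal rays of a convex set are expanding, so that the part of its boundary in a
ball has at most the measure of the boundary of an enclosing cube. -/
theorem hausdorffMeasure_frontier_inter_closedBall_le (hK : Convex ℝ K)
    (hint : (interior K).Nonempty) {d : ℝ} (hd : 0 ≤ d) (R : ℝ) :
    Measure.hausdorffMeasure d (frontier K ∩ Metric.closedBall 0 R) ≤
      Measure.hausdorffMeasure d {z : EuclideanSpace ℝ (Fin n) | ‖WithLp.ofLp z‖ = R} := by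
  set S := frontier K ∩ Metric.closedBall 0 R
  have hex : ∀ y : S, ∃ z : EuclideanSpace ℝ (Fin n), ‖WithLp.ofLp z‖ = R ∧
      ∀ x ∈ closure K, inner ℝ (x - y.1) (z - y.1) ≤ 0 := by
    rintro ⟨y, hyK, hyR⟩
    obtain ⟨ν, hν⟩ := exists_mem_unitNormals hK hint hyK
    obtain ⟨t, ht, htR⟩ := exists_norm_ofLp_add_smul_eq (ν := ν) (by simpa using hyR)
      (by rintro rfl; simpa using hν.1)
    refine ⟨y + t • ν, htR, fun x hx => ?_⟩
    rw [add_sub_cancel_left, inner_smul_right]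
    exact mul_nonpos_of_nonneg_of_nonpos ht (inner_sub_nonpos_of_mem_closure hν hx)
  -- An arbitrary choice of normals suffices: only the expansion property of z is used.
  choose z hzR hz using hex
  have hanti : AntilipschitzWith 1 z := by
    refine AntilipschitzWith.of_le_mul_dist fun y y' => ?_
    rw [NNReal.coe_one, one_mul, Subtype.dist_eq, dist_eq_norm, dist_eq_norm]
    have h1 := hz y y' (frontier_subset_closure y'.2.1)
    have h2 := hz y' y (frontier_subset_closure y.2.1)
    -- Adding the two normal inequalities shows that the displacements z y - y are monotone in y;
    -- Cauchy–Schwarz then gives expansion.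
    have h3 : ‖y.1 - y'.1‖ * ‖y.1 - y'.1‖ ≤ inner ℝ (y.1 - y'.1) (z y - z y') := by
      rw [← real_inner_self_eq_norm_mul_norm]
      have e1 : z y - z y' = (y.1 - y'.1) + (z y - y.1) - (z y' - y'.1) := by abel
      have e2 : (y'.1 : EuclideanSpace ℝ (Fin n)) - y.1 = -(y.1 - y'.1) := by abel
      rw [e2, inner_neg_left] at h1
      rw [e1, inner_sub_right _ _ (z y' - y'.1), inner_add_right]
      linarith
    have h4 := h3.trans (real_inner_le_norm _ _)
    rcases (norm_nonneg (y.1 - y'.1)).eq_or_lt with h | h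
    · rw [← h]; exact norm_nonneg _
    · exact le_of_mul_le_mul_left h4 h
  have h1 : Measure.hausdorffMeasure d S = Measure.hausdorffMeasure d (Set.univ : Set S) := by
    rw [← isometry_subtype_coe.hausdorffMeasure_image (Or.inl hd) Set.univ, Set.image_univ,
      Subtype.range_coe]
  rw [h1]
  refine (hanti.le_hausdorffMeasure_image hd _).trans ?_
  rw [ENNReal.coe_one, ENNReal.one_rpow, one_mul]
  refine measure_mono ?_
  rintro _ ⟨y, -, rfl⟩
  exact hzR y

/-- Functions decaying like `e^{-a|y|}`, up to a polynomial factor, are integrable over the boundary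
of a convex body with interior points. -/
theorem integrableOn_frontier_of_exp_decay (hn : 1 ≤ n) (hK : Convex ℝ K)
    (hint : (interior K).Nonempty) {f : EuclideanSpace ℝ (Fin n) → ℝ} (hf : Measurable f)
    {a C : ℝ} (ha : 0 < a) (hC : 0 ≤ C) (j : ℕ)
    (hbd : ∀ y ∈ frontier K, |f y| ≤ C * (1 + ‖y‖) ^ j * Real.exp (-a * ‖y‖)) :
    IntegrableOn f (frontier K) (Measure.hausdorffMeasure ((n : ℝ) - 1)) := by
  obtain ⟨m, rfl⟩ : ∃ m, n = m + 1 := ⟨n - 1, by omega⟩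
  have hnm : ((m + 1 : ℕ) : ℝ) - 1 = m := by push_cast; ring
  rw [hnm]
  obtain ⟨A, hA, hAle⟩ := exists_hausdorffMeasure_cube_boundary_le m
  refine ⟨hf.aestronglyMeasurable, ?_⟩
  set μ : Measure (EuclideanSpace ℝ (Fin (m + 1))) := Measure.hausdorffMeasure (m : ℝ)
  -- Shells of width one; their overlaps are harmless for an upper bound.
  let S : ℕ → Set (EuclideanSpace ℝ (Fin (m + 1))) := fun k =>
    frontier K ∩ {y | (k : ℝ) ≤ ‖y‖ ∧ ‖y‖ ≤ k + 1}
  have hSm : ∀ k, MeasurableSet (S k) := fun k =>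
    isClosed_frontier.measurableSet.inter (measurable_norm (measurableSet_Icc (a := (k : ℝ))))
  have hcov : frontier K ⊆ ⋃ k, S k := fun y hy => Set.mem_iUnion.2
    ⟨⌊‖y‖⌋₊, hy, Nat.floor_le (norm_nonneg _), (Nat.lt_floor_add_one _).le⟩
  let b : ℕ → ℝ := fun k => C * ((k : ℝ) + 2) ^ j * Real.exp (-a * k) * (A * ((k : ℝ) + 1) ^ m)
  have hb0 : ∀ k, 0 ≤ b k := fun k => by positivity
  have hS : ∀ k, ∫⁻ y in S k, ‖f y‖ₑ ∂μ ≤ ENNReal.ofReal (b k) := by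
    intro k
    have hμ : μ (S k) ≤ ENNReal.ofReal (A * ((k : ℝ) + 1) ^ m) := by
      refine (measure_mono ?_).trans ((hausdorffMeasure_frontier_inter_closedBall_le hK hint
        (Nat.cast_nonneg m) ((k : ℝ) + 1)).trans (hAle _ (by positivity)))
      rintro y ⟨hy, -, hy2⟩
      exact ⟨hy, by simpa using hy2⟩
    calc ∫⁻ y in S k, ‖f y‖ₑ ∂μ
        ≤ ∫⁻ _ in S k, ENNReal.ofReal (C * ((k : ℝ) + 2) ^ j * Real.exp (-a * k)) ∂μ := by
          refine setLIntegral_mono' (hSm k) fun y hy => ?_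
          rw [Real.enorm_eq_ofReal_abs]
          refine ENNReal.ofReal_le_ofReal ((hbd y hy.1).trans ?_)
          have h1 : (1 + ‖y‖) ^ j ≤ ((k : ℝ) + 2) ^ j :=
            pow_le_pow_left₀ (by positivity) (by linarith [hy.2.2]) _
          have h2 : Real.exp (-a * ‖y‖) ≤ Real.exp (-a * k) := by
            rw [Real.exp_le_exp]; nlinarith [hy.2.1]
          gcongr
      _ ≤ ENNReal.ofReal (b k) := by
          rw [setLIntegral_const, ENNReal.ofReal_mul (p := C * ((k : ℝ) + 2) ^ j * Real.exp (-a * k))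
            (by positivity)]
          gcongr
  have hsum : Summable b := by
    -- Reindexing by k + 2 matches the polynomial factors and costs e^{2a} in the exponential.
    have h0 : Summable fun k : ℕ => C * A * 2 ^ j * Real.exp (2 * a) *
        (((k + 2 : ℕ) : ℝ) ^ (j + m) * Real.exp (-a * ((k + 2 : ℕ) : ℝ))) :=
      ((summable_nat_add_iff 2).2 (Real.summable_pow_mul_exp_neg_nat_mul (j + m) ha)).mul_left _
    refine h0.of_nonneg_of_le hb0 fun k => ?_
    have e : Real.exp (2 * a) * Real.exp (-a * ((k + 2 : ℕ) : ℝ)) = Real.exp (-a * k) := by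
      rw [← Real.exp_add]; congr 1; push_cast; ring
    have h1 : ((k : ℝ) + 1) ^ m ≤ ((k : ℝ) + 2) ^ m :=
      pow_le_pow_left₀ (by positivity) (by linarith) _
    have h2 : (1 : ℝ) ≤ 2 ^ j := one_le_pow₀ (by norm_num)
    calc b k ≤ C * ((k : ℝ) + 2) ^ j * Real.exp (-a * k) * (A * ((k : ℝ) + 2) ^ m) * 2 ^ j := by
          refine le_trans ?_ (le_mul_of_one_le_right (by positivity) h2)
          simp only [b]; gcongr
      _ = _ := by rw [← e, pow_add]; push_cast; ring
  have hlt : ∫⁻ y in frontier K, ‖f y‖ₑ ∂μ < ⊤ := by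
    calc ∫⁻ y in frontier K, ‖f y‖ₑ ∂μ ≤ ∫⁻ y in ⋃ k, S k, ‖f y‖ₑ ∂μ := lintegral_mono_set hcov
      _ ≤ ∑' k, ∫⁻ y in S k, ‖f y‖ₑ ∂μ := lintegral_iUnion_le _ _
      _ ≤ ∑' k, ENNReal.ofReal (b k) := ENNReal.tsum_le_tsum hS
      _ < ⊤ := by
        rw [← ENNReal.ofReal_tsum_of_nonneg hb0 hsum]
        exact ENNReal.ofReal_lt_top
  exact hlt

end BoundaryMeasure

/-! ### The boundary integral and the conclusion -/

/-- Away from 0 a power of either sign grows at most polynomially: for p ≤ 0 the value at r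
dominates, for p ≥ 0 the power of 1 + t does. -/
theorem Real.rpow_le_rpow_add_one_mul_pow_ceil {r t p : ℝ} (hr : 0 < r) (hrt : r ≤ t) :
    t ^ p ≤ (r ^ p + 1) * (1 + t) ^ ⌈p⌉₊ := by
  have ht : 0 < t := hr.trans_le hrt
  have h1 : (1 : ℝ) ≤ (1 + t) ^ ⌈p⌉₊ := one_le_pow₀ (by linarith)
  have hrp : 0 < r ^ p := Real.rpow_pos_of_pos hr p
  rcases le_total p 0 with hp | hp
  · have h2 := Real.rpow_le_rpow_of_nonpos hr hrt hp
    nlinarith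
  · have h2 : t ^ p ≤ (1 + t) ^ ⌈p⌉₊ := by
      rw [← Real.rpow_natCast]
      exact (Real.rpow_le_rpow ht.le (by linarith) hp).trans
        (Real.rpow_le_rpow_of_exponent_le (by linarith) (Nat.le_ceil p))
    nlinarith

theorem IsConvCoe.integrableOn_frontier {n : ℕ} {u : EuclideanSpace ℝ (Fin n) → EReal}
    (hu : IsConvCoe u) (hn : 1 ≤ n) (p : ℝ)
    (h0 : (0 : EuclideanSpace ℝ (Fin n)) ∈ interior (effDom u))
    {ζ : EuclideanSpace ℝ (Fin n) → ℝ} (hζ : IsCrec ζ) :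
    IntegrableOn (fun y => |recFun ζ (gaussMap (effDom u) y)| * expNeg u y * ‖y‖ ^ p)
      (frontier (effDom u)) (Measure.hausdorffMeasure ((n : ℝ) - 1)) := by
  obtain ⟨a, ha, C, hC, hexp⟩ := hu.exists_expNeg_le (interior_subset h0)
  obtain ⟨B, hB, hrec⟩ := hζ.exists_abs_recFun_gaussMap_le (K := effDom u)
  obtain ⟨r, hr, hball⟩ := Metric.isOpen_iff.1 isOpen_interior 0 h0
  have hm : Measurable fun y => |recFun ζ (gaussMap (effDom u) y)| :=
    hζ.measurable_recFun_gaussMap.norm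
  refine integrableOn_frontier_of_exp_decay hn hu.toIsConv.convexOn_toReal.1 ⟨0, h0⟩
    ((hm.mul (measurable_expNeg hu.toIsConv)).mul (by fun_prop)) ha
    (C := B * C * (r ^ p + 1)) (by positivity) ⌈p⌉₊ fun y hy => ?_
  -- A frontier point is not interior, so it lies outside the ball about 0; the weight has no
  -- singularity there.
  have hry : r ≤ ‖y‖ := by
    by_contra! h
    exact hy.2 (hball (by simpa using h))
  have he := expNeg_nonneg (u := u) y
  rw [abs_of_nonneg (by positivity)]
  calc _ ≤ B * (C * Real.exp (-a * ‖y‖)) * ((r ^ p + 1) * (1 + ‖y‖) ^ ⌈p⌉₊) := by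
        gcongr
        · exact hrec y
        · exact hexp y
        · exact Real.rpow_le_rpow_add_one_mul_pow_ceil hr hry
    _ = _ := by ring

theorem lemma4p4 (n : ℕ) (hn : 1 ≤ n) (q : ℝ) (hq : 0 < q)
    (u : EuclideanSpace ℝ (Fin n) → EReal) (hu : IsConvCoe u)
    (h0 : (0 : EuclideanSpace ℝ (Fin n)) ∈ interior (effDom u))
    (ζ : EuclideanSpace ℝ (Fin n) → ℝ) (hζ : IsCrec ζ)
    (hLip : ∃ L : NNReal, LipschitzWith L ζ) :
    Integrable
        (fun x => |ζ (grad u x)| * expNeg u x * ‖x‖ ^ (q - (n : ℝ)))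
        (volume : Measure (EuclideanSpace ℝ (Fin n))) ∧
      IntegrableOn
        (fun y => |recFun ζ (gaussMap (effDom u) y)| * expNeg u y * ‖y‖ ^ (q - (n : ℝ)))
        (frontier (effDom u))
        (Measure.hausdorffMeasure ((n : ℝ) - 1) : Measure (EuclideanSpace ℝ (Fin n))) := by
  obtain ⟨L, hL⟩ := hLip
  exact ⟨hu.integrable_comp_grad_mul_expNeg_mul_rpow hn hq h0 hL,
    hu.integrableOn_frontier hn _ h0 hζ⟩
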